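/- Let $B_2^n$ be the Euclidean unit ball of $\mathbb{R}^n$, $n\ge 1$. For convex bodies $K,L\subset\mathbb{R}^n$ let $$d(K,L)=\inf\{ab : a,b>0,\ \tfrac1a K\subseteq L\subseteq bK\},\qquad d_{BM}(K,L)=\inf\{d(K,T(L)) : T:\mathbb{R}^n\to\mathbb{R}^n \text{ linear}\}$$ be the geometric and the Banach–Mazur distance (with $\inf\emptyset=\infty$). For a convex body $K\subset\mathbb{R}^n$ with $K=-K$ and volume $|K|=1$, and for $\delta\in(0,1)$, let $$K_\delta=\bigcap_{\theta\in S^{n-1}}\{x\in K : |\langle x,\theta\rangle|\le t_\theta\},\qquad t_\theta=\sup\{t>0 : |\{x\in K : |\langle x,\theta\rangle|\le t\}|=1-\delta\}$$ be its floating body. Then there are universal constants $c_1,c_2,c_3,c_4>0$ (independent of $n$, $K$ and $\delta$) such that for every $n\ge1$, every convex body $K\subset\mathbb{R}^n$ with $K=-K$ and $|K|=1$, and every $\delta\in(0,1)$, $$d_{BM}(K_\delta,B_2^n)\le c_1\max\{\log\tfrac1\delta,\,1\},$$ $$c_3\,d(K_\delta,K)\le d(K_\delta,K_{e^{-n}})\le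 c_4\,d(K_\delta,K),\qquad d(K_\delta,K_{e^{-n}})\le c_2\max\Big\{\frac{n}{\log(1/\delta)},\,1\Big\}.$$ -/

import Mathlib

open Set MeasureTheory
open scoped Pointwise ENNReal

noncomputable section

/-- `t_θ = sup {t > 0 : |{x ∈ K : |⟨x, θ⟩| ≤ t}| = 1 - δ}`, half the width of the slab orthogonal
to `θ` outside which a symmetric body `K` of volume one has volume `δ`. -/
def slabHalfWidth {n : ℕ} (K : Set (EuclideanSpace ℝ (Fin n))) (δ : ℝ)
    (θ : EuclideanSpace ℝ (Fin n)) : ℝ :=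
  sSup {t : ℝ | 0 < t ∧ volume {x ∈ K | |inner ℝ x θ| ≤ t} = ENNReal.ofReal (1 - δ)}

/-- The floating body `K_δ` of a symmetric convex body `K` of volume one. -/
def floatingBody {n : ℕ} (K : Set (EuclideanSpace ℝ (Fin n))) (δ : ℝ) :
    Set (EuclideanSpace ℝ (Fin n)) :=
  ⋂ θ ∈ Metric.sphere (0 : EuclideanSpace ℝ (Fin n)) 1,
    {x ∈ K | |inner ℝ x θ| ≤ slabHalfWidth K δ θ}

/-- The geometric distance `d(K, L) = inf {a b : a, b > 0, (1/a) K ⊆ L ⊆ b K}`, an extended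
nonnegative real, so that it is `∞` when there are no such `a` and `b`. -/
def geometricDist {n : ℕ} (K L : Set (EuclideanSpace ℝ (Fin n))) : ℝ≥0∞ :=
  sInf {r : ℝ≥0∞ | ∃ a b : ℝ, 0 < a ∧ 0 < b ∧ (1 / a) • K ⊆ L ∧ L ⊆ b • K ∧
    r = ENNReal.ofReal (a * b)}

/-- The Banach-Mazur distance `d_BM(K, L) = inf {d(K, T(L)) : T a linear operator}`; for bodies
with nonempty interior a singular `T` contributes the value `∞`. -/
def banachMazurDist {n : ℕ} (K L : Set (EuclideanSpace ℝ (Fin n))) : ℝ≥0∞ :=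
  ⨅ T : EuclideanSpace ℝ (Fin n) →ₗ[ℝ] EuclideanSpace ℝ (Fin n), geometricDist K (T '' L)

end

/-! Fix θ and let g(t) be the volume of the part of K where |⟨x, θ⟩| > t, so g(0) = 1 and g(t_θ(δ))
= δ. Brunn–Minkowski for the caps of K gives g(t)^s ≤ g(st) for 0 < s ≤ 1
(`rpow_volume_slabCompl_le`), so t_θ(δ) / log(1/δ) is nondecreasing in δ. Hence t_θ(δ) lies between
t_θ(1/2) and 2 log(1/δ) t_θ(1/2) when δ ≤ 1/2. When δ ≥ 1/2 it lies between (1 - δ) and 4(1 - δ)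
times t_θ(1/2), the upper bound because the central strip of K is the largest of its width.

The median t_θ(1/2) is comparable to (∫_K ⟨x, θ⟩²)^(1/2): Markov in one direction, geometric decay
of the tails in the other. This root second moment is the support function of an ellipsoid, and K_δ
is cut out by its slabs alone (`mem_floatingBody_of_forall`), so K_δ lies between two multiples of
that ellipsoid. The ratio of the multiples bounds the Banach–Mazur distance.

For the geometric distances, contract half of K by s = δ^(1/n) towards a point x of K. The copy has
volume δ/2 and stays in a cap, which gives (1 - s)K ⊆ K_δ ⊆ K (`smul_subset_floatingBody`). At δ =
e^(-n) this makes K and K_{e^(-n)} agree up to a factor 2, and in general 1/(1 - s) ≤ n / log(1/δ) +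
1. -/

/-! ### Prékopa–Leindler and Brunn–Minkowski inequalities. -/

theorem ENNReal.geom_mean_le_arith_mean2 {a b : ℝ} (ha : 0 < a) (hb : 0 < b) (hab : a + b = 1)
    (p q : ℝ≥0∞) : p ^ a * q ^ b ≤ ENNReal.ofReal a * p + ENNReal.ofReal b * q := by
  by_cases hp : p = ⊤
  · simp [hp, ENNReal.mul_top, ha]
  by_cases hq : q = ⊤
  · simp [hq, ENNReal.mul_top, hb]
  lift p to NNReal using hp
  lift q to NNReal using hq
  rw [← ENNReal.coe_rpow_of_nonneg _ ha.le, ← ENNReal.coe_rpow_of_nonneg _ hb.le, ENNReal.ofReal,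
    ENNReal.ofReal]
  norm_cast
  have := NNReal.geom_mean_le_arith_mean2_weighted a.toNNReal b.toNNReal p q
    (by rw [← Real.toNNReal_add ha.le hb.le, hab, Real.toNNReal_one])
  simpa [ha.le, hb.le] using this

/-- The one-dimensional Brunn–Minkowski inequality. -/
theorem Real.volume_add_le_of_add_mem {A B C : Set ℝ} (hA : MeasurableSet A)
    (hB : MeasurableSet B) (hA0 : A.Nonempty) (hB0 : B.Nonempty)
    (hC : ∀ x ∈ A, ∀ y ∈ B, x + y ∈ C) : volume A + volume B ≤ volume C := by
  have compact_case : ∀ A' ⊆ A, ∀ B' ⊆ B, IsCompact A' → IsCompact B' → A'.Nonempty →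
      B'.Nonempty → volume A' + volume B' ≤ volume C := by
    intro A' hA' B' hB' cA cB nA nB
    -- With p = max A' and q = min B', the translates A' + q and p + B' both lie in C and meet at
    -- most in the point p + q.
    obtain ⟨p, hp, hpm⟩ := cA.exists_isGreatest nA
    obtain ⟨q, hq, hqm⟩ := cB.exists_isLeast nB
    have e1 : volume A' = volume ((fun x => x + q) '' A') := by simp
    have e2 : volume B' = volume ((fun x => p + x) '' B') := by simp
    have hd : AEDisjoint volume ((fun x => x + q) '' A') ((fun x => p + x) '' B') := by
      refine measure_mono_null (t := {p + q}) ?_ (by simp)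
      rintro _ ⟨⟨x, hx, rfl⟩, ⟨y, hy, hxy⟩⟩
      have h1 := hpm hx
      have h2 := hqm hy
      simp only [mem_singleton_iff] at hxy ⊢
      linarith
    rw [e1, e2, ← measure_union₀ _ hd]
    · refine measure_mono ?_
      rintro _ (⟨x, hx, rfl⟩ | ⟨y, hy, rfl⟩)
      · exact hC _ (hA' hx) _ (hB' hq)
      · exact hC _ (hA' hp) _ (hB' hy)
    · exact ((cB.image (by fun_prop)).measurableSet).nullMeasurableSet
  have key : ∀ r < volume A, ∀ s < volume B, r + s ≤ volume C := by
    intro r hr s hs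
    obtain ⟨A', hA', cA, hrA⟩ := hA.exists_lt_isCompact hr
    obtain ⟨B', hB', cB, hsB⟩ := hB.exists_lt_isCompact hs
    refine (add_le_add hrA.le hsB.le).trans (compact_case A' hA' B' hB' cA cB ?_ ?_)
    · exact nonempty_of_measure_ne_zero (ne_bot_of_gt hrA)
    · exact nonempty_of_measure_ne_zero (ne_bot_of_gt hsB)
  obtain ⟨x₀, hx₀⟩ := hA0
  obtain ⟨y₀, hy₀⟩ := hB0
  rcases eq_or_ne (volume A) 0 with h | h
  · rw [h, zero_add]
    calc volume B = volume ((fun x => x₀ + x) '' B) := by simp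
      _ ≤ _ := measure_mono (by rintro _ ⟨y, hy, rfl⟩; exact hC _ hx₀ _ hy)
  rcases eq_or_ne (volume B) 0 with h' | h'
  · rw [h', add_zero]
    calc volume A = volume ((fun x => x + y₀) '' A) := by simp
      _ ≤ _ := measure_mono (by rintro _ ⟨y, hy, rfl⟩; exact hC _ hy _ hy₀)
  refine le_of_forall_lt fun c hc => ?_
  obtain ⟨r, hr, s, hs, hrs⟩ := ENNReal.exists_lt_add_of_lt_add hc h h'
  exact hrs.trans_le (key r hr s hs)

theorem Real.volume_weighted_add_le {a b : ℝ} (ha : 0 < a) (hb : 0 < b) {A B C : Set ℝ}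
    (hA : MeasurableSet A) (hB : MeasurableSet B) (hA0 : A.Nonempty) (hB0 : B.Nonempty)
    (hC : ∀ x ∈ A, ∀ y ∈ B, a * x + b * y ∈ C) :
    ENNReal.ofReal a * volume A + ENNReal.ofReal b * volume B ≤ volume C := by
  have := Real.volume_add_le_of_add_mem (A := a • A) (B := b • B) (C := C)
    (hA.const_smul₀ a) (hB.const_smul₀ b) hA0.smul_set hB0.smul_set (by
      rintro _ ⟨x, hx, rfl⟩ _ ⟨y, hy, rfl⟩
      exact hC x hx y hy)
  simpa [Measure.addHaar_smul, abs_of_pos ha, abs_of_pos hb] using this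

theorem lintegral_eq_lintegral_Ioo_meas_lt {f : ℝ → ℝ≥0∞} (hf : Measurable f) (h1 : ∀ x, f x ≤ 1) :
    ∫⁻ x, f x = ∫⁻ t in Ioo (0 : ℝ) 1, volume {x | ENNReal.ofReal t < f x} := by
  have hfin : ∀ x, f x ≠ ⊤ := fun x => ne_top_of_le_ne_top ENNReal.one_ne_top (h1 x)
  have h := lintegral_eq_lintegral_meas_lt (volume : Measure ℝ) (f := fun x => (f x).toReal)
    (Filter.Eventually.of_forall fun x => ENNReal.toReal_nonneg) hf.ennreal_toReal.aemeasurable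
  simp_rw [ENNReal.ofReal_toReal (hfin _)] at h
  rw [h, ← Ioo_union_Ici_eq_Ioi (zero_lt_one' ℝ), lintegral_union measurableSet_Ici
    (by rw [Set.disjoint_left]; rintro x ⟨_, h1⟩ h2; exact absurd h1 (not_lt.2 h2))]
  have h0 : ∫⁻ t in Ici (1 : ℝ), volume {x | t < (f x).toReal} = 0 := by
    rw [setLIntegral_congr_fun (g := fun _ => 0) measurableSet_Ici, lintegral_zero]
    intro t ht
    have : {x | t < (f x).toReal} = ∅ := by
      ext x
      simp only [mem_ofPred_eq, mem_empty_iff_false, iff_false, not_lt]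
      exact le_trans (by simpa using ENNReal.toReal_mono ENNReal.one_ne_top (h1 x)) ht
    simp [this]
  rw [h0, add_zero]
  refine setLIntegral_congr_fun measurableSet_Ioo fun t ht => ?_
  congr 1
  ext x
  exact (ENNReal.ofReal_lt_iff_lt_toReal ht.1.le (hfin x)).symm

/-- The Prékopa–Leindler inequality on the line for functions with supremum one, in its
arithmetic form. -/
theorem arith_prekopaLeindler_of_iSup_eq_one {a b : ℝ} (ha : 0 < a) (hb : 0 < b) (hab : a + b = 1)
    {f g h : ℝ → ℝ≥0∞} (hf : Measurable f) (hg : Measurable g) (hh : Measurable h)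
    (f1 : ⨆ x, f x = 1) (g1 : ⨆ x, g x = 1)
    (H : ∀ x y, f x ^ a * g y ^ b ≤ h (a * x + b * y)) :
    ENNReal.ofReal a * (∫⁻ x, f x) + ENNReal.ofReal b * (∫⁻ x, g x) ≤ ∫⁻ x, h x := by
  have fle : ∀ x, f x ≤ 1 := fun x => f1 ▸ le_iSup f x
  have gle : ∀ x, g x ≤ 1 := fun x => g1 ▸ le_iSup g x
  -- Cutting h at 1 puts all three layer-cake integrals on the levels in (0, 1). There the
  -- superlevel sets of f and g are nonempty, as one-dimensional Brunn–Minkowski requires.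
  calc _ ≤ ∫⁻ x, min (h x) 1 := ?_
    _ ≤ _ := lintegral_mono fun x => min_le_left _ _
  rw [lintegral_eq_lintegral_Ioo_meas_lt hf fle, lintegral_eq_lintegral_Ioo_meas_lt hg gle,
    lintegral_eq_lintegral_Ioo_meas_lt (hh.min measurable_const) (fun x => min_le_right _ _),
    ← lintegral_const_mul', ← lintegral_const_mul', ← lintegral_add_left']
  · refine setLIntegral_mono' measurableSet_Ioo fun t ht => ?_
    have ht1 : ENNReal.ofReal t < 1 := by simpa using ht.2
    obtain ⟨x₀, hx₀⟩ := lt_iSup_iff.1 (f1.symm ▸ ht1)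
    obtain ⟨y₀, hy₀⟩ := lt_iSup_iff.1 (g1.symm ▸ ht1)
    refine Real.volume_weighted_add_le ha hb (measurableSet_lt measurable_const hf)
      (measurableSet_lt measurable_const hg) ⟨x₀, hx₀⟩ ⟨y₀, hy₀⟩ fun x hx y hy => ?_
    refine lt_min (lt_of_lt_of_le ?_ (H x y)) ht1
    have e : ENNReal.ofReal t = ENNReal.ofReal t ^ a * ENNReal.ofReal t ^ b := by
      rw [← ENNReal.rpow_add_of_nonneg _ _ ha.le hb.le, hab, ENNReal.rpow_one]
    rw [e]
    exact ENNReal.mul_lt_mul (ENNReal.rpow_lt_rpow hx ha) (ENNReal.rpow_lt_rpow hy hb)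
  · refine (Measurable.const_mul (Antitone.measurable ?_) _).aemeasurable
    exact fun s t hst => measure_mono fun x hx => (ENNReal.ofReal_le_ofReal hst).trans_lt hx
  · exact ENNReal.ofReal_ne_top
  · exact ENNReal.ofReal_ne_top

/-- Dividing f and g by their suprema reduces to the arithmetic form, and AM–GM turns that into the
geometric form, which is homogeneous. -/
theorem prekopaLeindler_real_of_bounded {a b : ℝ} (ha : 0 < a) (hb : 0 < b) (hab : a + b = 1)
    {f g h : ℝ → ℝ≥0∞} (hf : Measurable f) (hg : Measurable g) (hh : Measurable h)
    (f1 : ⨆ x, f x ≠ ⊤) (g1 : ⨆ x, g x ≠ ⊤)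
    (H : ∀ x y, f x ^ a * g y ^ b ≤ h (a * x + b * y)) :
    (∫⁻ x, f x) ^ a * (∫⁻ x, g x) ^ b ≤ ∫⁻ x, h x := by
  set M := ⨆ x, f x with hM
  set N := ⨆ x, g x with hN
  rcases eq_or_ne M 0 with hM0 | hM0
  · have : f = 0 := by
      ext x; exact le_antisymm ((le_iSup f x).trans hM0.le) zero_le
    simp [this, ha]
  rcases eq_or_ne N 0 with hN0 | hN0
  · have : g = 0 := by
      ext x; exact le_antisymm ((le_iSup g x).trans hN0.le) zero_le
    simp [this, hb]
  have Ma0 : M ^ a ≠ 0 := by simp [ENNReal.rpow_eq_zero_iff, hM0, ha.not_gt]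
  have Nb0 : N ^ b ≠ 0 := by simp [ENNReal.rpow_eq_zero_iff, hN0, hb.not_gt]
  have Mat : M ^ a ≠ ⊤ := ENNReal.rpow_ne_top_of_nonneg ha.le f1
  have Nbt : N ^ b ≠ ⊤ := ENNReal.rpow_ne_top_of_nonneg hb.le g1
  set P := M ^ a * N ^ b with hP
  have P0 : P ≠ 0 := mul_ne_zero Ma0 Nb0
  have Pt : P ≠ ⊤ := ENNReal.mul_ne_top Mat Nbt
  have key := arith_prekopaLeindler_of_iSup_eq_one ha hb hab (f := fun x => M⁻¹ * f x)
    (g := fun x => N⁻¹ * g x) (h := fun x => P⁻¹ * h x) (hf.const_mul _) (hg.const_mul _)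
    (hh.const_mul _) (by rw [← ENNReal.mul_iSup]; exact ENNReal.inv_mul_cancel hM0 f1)
    (by rw [← ENNReal.mul_iSup]; exact ENNReal.inv_mul_cancel hN0 g1) (by
      intro x y
      rw [ENNReal.mul_rpow_of_nonneg _ _ ha.le, ENNReal.mul_rpow_of_nonneg _ _ hb.le,
        ENNReal.inv_rpow, ENNReal.inv_rpow, hP, ENNReal.mul_inv (Or.inl Ma0) (Or.inl Mat)]
      calc _ = (M ^ a)⁻¹ * (N ^ b)⁻¹ * (f x ^ a * g y ^ b) := by ring
        _ ≤ _ := by gcongr; exact H x y)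
  have key2 := (ENNReal.geom_mean_le_arith_mean2 ha hb hab _ _).trans key
  rw [lintegral_const_mul _ hf, lintegral_const_mul _ hg, lintegral_const_mul _ hh,
    ENNReal.mul_rpow_of_nonneg _ _ ha.le, ENNReal.mul_rpow_of_nonneg _ _ hb.le,
        ENNReal.inv_rpow, ENNReal.inv_rpow] at key2
  have key3 : P⁻¹ * ((∫⁻ x, f x) ^ a * (∫⁻ x, g x) ^ b) ≤ P⁻¹ * ∫⁻ x, h x := by
    refine le_trans (le_of_eq ?_) key2
    rw [hP, ENNReal.mul_inv (Or.inl Ma0) (Or.inl Mat)]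
    ring
  exact (ENNReal.mul_le_mul_iff_right (ENNReal.inv_ne_zero.2 Pt) (ENNReal.inv_ne_top.2 P0)).1 key3

/-- Truncate f and g at height N and let N → ∞ by monotone convergence. Vanishing integrals are set
aside because multiplication on `ℝ≥0∞` is discontinuous at (0, ∞). -/
theorem prekopaLeindler_real {a b : ℝ} (ha : 0 < a) (hb : 0 < b) (hab : a + b = 1)
    {f g h : ℝ → ℝ≥0∞} (hf : Measurable f) (hg : Measurable g) (hh : Measurable h)
    (H : ∀ x y, f x ^ a * g y ^ b ≤ h (a * x + b * y)) :
    (∫⁻ x, f x) ^ a * (∫⁻ x, g x) ^ b ≤ ∫⁻ x, h x := by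
  rcases eq_or_ne (∫⁻ x, f x) 0 with hf0 | hf0
  · simp [hf0, ha]
  rcases eq_or_ne (∫⁻ x, g x) 0 with hg0 | hg0
  · simp [hg0, hb]
  have trunc : ∀ {f : ℝ → ℝ≥0∞}, Measurable f →
      Filter.Tendsto (fun N : ℕ => ∫⁻ x, min (f x) N) Filter.atTop (nhds (∫⁻ x, f x)) := by
    intro f hf
    refine lintegral_tendsto_of_tendsto_of_monotone (fun N => (hf.min measurable_const).aemeasurable)
      (Filter.Eventually.of_forall fun x => ?_) (Filter.Eventually.of_forall fun x => ?_)
    · intro m n hmn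
      exact min_le_min le_rfl (by exact_mod_cast hmn)
    · have := (tendsto_const_nhds (x := f x)).min ENNReal.tendsto_nat_nhds_top
      simpa using this
  have hlim := ENNReal.Tendsto.mul
    ((ENNReal.continuous_rpow_const (y := a)).continuousAt.tendsto.comp (trunc hf))
    (Or.inl (by simp [ENNReal.rpow_eq_zero_iff, hf0, ha.not_gt]))
    ((ENNReal.continuous_rpow_const (y := b)).continuousAt.tendsto.comp (trunc hg))
    (Or.inl (by simp [ENNReal.rpow_eq_zero_iff, hg0, hb.not_gt]))
  refine le_of_tendsto' hlim fun N => ?_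
  have hbd : ∀ f : ℝ → ℝ≥0∞, ⨆ x, min (f x) (N : ℝ≥0∞) ≠ ⊤ := fun f =>
    ne_top_of_le_ne_top (ENNReal.natCast_ne_top N) (iSup_le fun x => min_le_right _ _)
  refine prekopaLeindler_real_of_bounded ha hb hab (hf.min measurable_const)
    (hg.min measurable_const) hh (hbd f) (hbd g) fun x y => le_trans ?_ (H x y)
  gcongr <;> exact min_le_left _ _

/-- The Prékopa–Leindler inequality. -/
theorem prekopaLeindler {a b : ℝ} (ha : 0 < a) (hb : 0 < b) (hab : a + b = 1) {n : ℕ}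
    {f g h : (Fin n → ℝ) → ℝ≥0∞} (hf : Measurable f) (hg : Measurable g) (hh : Measurable h)
    (H : ∀ x y, f x ^ a * g y ^ b ≤ h (a • x + b • y)) :
    (∫⁻ x, f x) ^ a * (∫⁻ x, g x) ^ b ≤ ∫⁻ x, h x := by
  induction n with
  | zero =>
    have e : (volume : Measure (Fin 0 → ℝ)) = Measure.dirac 0 := by
      rw [volume_pi]; exact Measure.pi_of_empty _ _
    rw [e, lintegral_dirac, lintegral_dirac, lintegral_dirac]
    simpa using H 0 0
  | succ n ih =>
    let e := (MeasurableEquiv.piFinSuccAbove (fun _ : Fin (n + 1) => ℝ) 0).symm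
    have me : Measurable e := e.measurable
    have split : ∀ f : (Fin (n + 1) → ℝ) → ℝ≥0∞, Measurable f →
        ∫⁻ x, f x = ∫⁻ s : ℝ, ∫⁻ z : Fin n → ℝ, f (e (s, z)) := by
      intro f hf
      have mp := (volume_preserving_piFinSuccAbove (fun _ : Fin (n + 1) => ℝ) 0).symm
      rw [← mp.lintegral_comp hf, Measure.volume_eq_prod]
      exact lintegral_prod _ (hf.comp me).aemeasurable
    have he : ∀ (s t : ℝ) (z w : Fin n → ℝ),
        a • e (s, z) + b • e (t, w) = e (a * s + b * t, a • z + b • w) := by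
      intro s t z w
      ext i
      refine Fin.cases ?_ (fun j => ?_) i <;>
        simp [e, MeasurableEquiv.piFinSuccAbove, Fin.insertNthEquiv]
    rw [split f hf, split g hg, split h hh]
    -- The induction hypothesis on the fibres is exactly the one-dimensional hypothesis for the
    -- marginals.
    refine prekopaLeindler_real ha hb hab (hf.comp me).lintegral_prod_right'
      (hg.comp me).lintegral_prod_right' (hh.comp me).lintegral_prod_right' fun s t => ?_
    refine ih (hf.comp (me.comp measurable_prodMk_left)) (hg.comp (me.comp measurable_prodMk_left))
      (hh.comp (me.comp measurable_prodMk_left)) fun z w => ?_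
    simpa [he] using H (e (s, z)) (e (t, w))

/-- The multiplicative Brunn–Minkowski inequality. -/
theorem rpow_volume_mul_rpow_volume_le {a b : ℝ} (ha : 0 < a) (hb : 0 < b) (hab : a + b = 1)
    {n : ℕ} {A B C : Set (EuclideanSpace ℝ (Fin n))} (hA : MeasurableSet A)
    (hB : MeasurableSet B) (hC : MeasurableSet C) (H : ∀ x ∈ A, ∀ y ∈ B, a • x + b • y ∈ C) :
    volume A ^ a * volume B ^ b ≤ volume C := by
  have mt := (PiLp.volume_preserving_toLp (Fin n)).measurable
  have e : ∀ S : Set (EuclideanSpace ℝ (Fin n)), MeasurableSet S →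
      volume S = ∫⁻ x : Fin n → ℝ, S.indicator 1 (WithLp.toLp 2 x) := by
    intro S hS
    rw [(PiLp.volume_preserving_toLp (Fin n)).lintegral_comp (measurable_one.indicator hS),
      lintegral_indicator_one hS]
  rw [e A hA, e B hB, e C hC]
  refine prekopaLeindler ha hb hab ((measurable_one.indicator hA).comp mt)
    ((measurable_one.indicator hB).comp mt) ((measurable_one.indicator hC).comp mt) fun x y => ?_
  by_cases hx : WithLp.toLp 2 x ∈ A
  · by_cases hy : WithLp.toLp 2 y ∈ B
    · have := H _ hx _ hy
      simp [hx, hy, this]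
    · simp [hy, hb]
  · simp [hx, ha]

/-! ### Slabs and caps of symmetric bodies of volume one. -/

/-- A compact convex origin-symmetric set of volume one. -/
structure IsSymmUnitBody {n : ℕ} (K : Set (EuclideanSpace ℝ (Fin n))) : Prop where
  convex : Convex ℝ K
  isCompact : IsCompact K
  neg_mem : ∀ x ∈ K, -x ∈ K
  volume_eq : volume K = 1

/-- The part of `K` in the slab of half-width `t` orthogonal to `θ`. -/
def slab {n : ℕ} (K : Set (EuclideanSpace ℝ (Fin n))) (θ : EuclideanSpace ℝ (Fin n)) (t : ℝ) :
    Set (EuclideanSpace ℝ (Fin n)) :=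
  {x ∈ K | |inner ℝ x θ| ≤ t}

/-- The part of `K` outside the slab of half-width `t` orthogonal to `θ`. -/
def slabCompl {n : ℕ} (K : Set (EuclideanSpace ℝ (Fin n))) (θ : EuclideanSpace ℝ (Fin n))
    (t : ℝ) : Set (EuclideanSpace ℝ (Fin n)) :=
  {x ∈ K | t < |inner ℝ x θ|}

/-- The cap of `K` cut off by the halfspace `⟨x, θ⟩ > t`. -/
def cap {n : ℕ} (K : Set (EuclideanSpace ℝ (Fin n))) (θ : EuclideanSpace ℝ (Fin n)) (t : ℝ) :
    Set (EuclideanSpace ℝ (Fin n)) :=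
  {x ∈ K | t < inner ℝ x θ}

theorem measurable_inner_right {n : ℕ} {θ : EuclideanSpace ℝ (Fin n)} :
    Measurable fun x : EuclideanSpace ℝ (Fin n) => (inner ℝ x θ : ℝ) := by fun_prop

theorem measurable_abs_inner {n : ℕ} {θ : EuclideanSpace ℝ (Fin n)} :
    Measurable fun x : EuclideanSpace ℝ (Fin n) => |(inner ℝ x θ : ℝ)| := by fun_prop

theorem volume_hyperplane {n : ℕ} {θ : EuclideanSpace ℝ (Fin n)} (hθ : θ ≠ 0) (c : ℝ) :
    volume {x : EuclideanSpace ℝ (Fin n) | inner ℝ x θ = c} = 0 := by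
  let s : AffineSubspace ℝ (EuclideanSpace ℝ (Fin n)) :=
    { carrier := {x | inner ℝ x θ = c}
      smul_vsub_vadd_mem' := by
        intro r x y z hx hy hz
        simp only [mem_ofPred_eq] at hx hy hz ⊢
        simp [inner_add_left, inner_smul_left, inner_sub_left, hx, hy, hz] }
  refine Measure.addHaar_affineSubspace volume s fun h => ?_
  have h1 : ∀ x, inner ℝ x θ = c := fun x => by
    have : x ∈ s := by rw [h]; trivial
    exact this
  have h2 : inner ℝ θ θ = (0 : ℝ) := by rw [h1 θ, ← h1 0, inner_zero_left]
  exact hθ (inner_self_eq_zero.1 h2)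

theorem volume_abs_inner_eq {n : ℕ} {θ : EuclideanSpace ℝ (Fin n)} (hθ : θ ≠ 0) (c : ℝ) :
    volume {x : EuclideanSpace ℝ (Fin n) | |inner ℝ x θ| = c} = 0 := by
  refine measure_mono_null (t := {x | inner ℝ x θ = c} ∪ {x | inner ℝ x θ = -c}) ?_
    (measure_union_null (volume_hyperplane hθ _) (volume_hyperplane hθ _))
  intro x hx
  have hx' : |inner ℝ x θ| = c := hx
  rcases abs_choice (inner ℝ x θ) with h | h
  · exact Or.inl (h.symm.trans hx')
  · exact Or.inr (by rw [mem_ofPred_eq]; linarith)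

namespace IsSymmUnitBody

variable {n : ℕ} {K : Set (EuclideanSpace ℝ (Fin n))} {θ : EuclideanSpace ℝ (Fin n)} {δ t s : ℝ}

theorem measurableSet (hK : IsSymmUnitBody K) : MeasurableSet K := hK.isCompact.measurableSet

theorem measurableSet_slab (hK : IsSymmUnitBody K) : MeasurableSet (slab K θ t) :=
  hK.measurableSet.inter (measurableSet_le measurable_abs_inner measurable_const)

theorem measurableSet_slabCompl (hK : IsSymmUnitBody K) : MeasurableSet (slabCompl K θ t) :=
  hK.measurableSet.inter (measurableSet_lt measurable_const measurable_abs_inner)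

theorem measurableSet_cap (hK : IsSymmUnitBody K) : MeasurableSet (cap K θ t) :=
  hK.measurableSet.inter (measurableSet_lt measurable_const measurable_inner_right)

theorem volume_ne_top_of_subset (hK : IsSymmUnitBody K) {S : Set (EuclideanSpace ℝ (Fin n))}
    (hS : S ⊆ K) : volume S ≠ ⊤ :=
  ne_top_of_le_ne_top ENNReal.one_ne_top (hK.volume_eq ▸ measure_mono hS)

theorem measureReal_mono (hK : IsSymmUnitBody K) {S S' : Set (EuclideanSpace ℝ (Fin n))}
    (h : S ⊆ S') (hS : S' ⊆ K) : volume.real S ≤ volume.real S' :=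
  MeasureTheory.measureReal_mono h (hK.volume_ne_top_of_subset hS)

theorem slab_add_slabCompl (hK : IsSymmUnitBody K) :
    volume.real (slab K θ t) + volume.real (slabCompl K θ t) = 1 := by
  rw [← measureReal_union _ hK.measurableSet_slabCompl
    (hK.volume_ne_top_of_subset fun x hx => hx.1) (hK.volume_ne_top_of_subset fun x hx => hx.1)]
  · have : slab K θ t ∪ slabCompl K θ t = K := by
      ext x
      constructor
      · rintro (h | h) <;> exact h.1
      · intro h
        rcases le_or_gt |inner ℝ x θ| t with h' | h'
        exacts [Or.inl ⟨h, h'⟩, Or.inr ⟨h, h'⟩]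
    simp [this, Measure.real, hK.volume_eq]
  · rw [Set.disjoint_left]
    exact fun x h1 h2 => not_lt.2 h1.2 h2.2

theorem slab_mono (hK : IsSymmUnitBody K) (h : s ≤ t) :
    volume.real (slab K θ s) ≤ volume.real (slab K θ t) :=
  hK.measureReal_mono (fun _ hx => ⟨hx.1, hx.2.trans h⟩) fun _ hx => hx.1

theorem slab_zero (hθ : θ ≠ 0) : volume.real (slab K θ 0) = 0 := by
  have : volume (slab K θ 0) = 0 :=
    measure_mono_null (fun x hx => le_antisymm hx.2 (abs_nonneg _)) (volume_abs_inner_eq hθ 0)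
  simp [Measure.real, this]

/-- Dominated convergence: the indicator of the slab jumps at `t` only on two hyperplanes, which are
null. -/
theorem continuous_slab (hK : IsSymmUnitBody K) (hθ : θ ≠ 0) :
    Continuous fun t => volume.real (slab K θ t) := by
  have e : ∀ t, volume.real (slab K θ t) =
      ∫ x in K, {x | |inner ℝ x θ| ≤ t}.indicator (fun _ => (1 : ℝ)) x := by
    intro t
    have hm : MeasurableSet {x : EuclideanSpace ℝ (Fin n) | |inner ℝ x θ| ≤ t} :=
      measurableSet_le (by fun_prop) measurable_const
    rw [integral_indicator hm]
    simp only [integral_const, smul_eq_mul, mul_one]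
    rw [measureReal_restrict_apply_univ, measureReal_restrict_apply hm, inter_comm]
    rfl
  simp_rw [e]
  rw [continuous_iff_continuousAt]
  intro t
  refine continuousAt_of_dominated (bound := fun _ => 1) ?_ ?_ ?_ ?_
  · refine Filter.Eventually.of_forall fun t => ?_
    exact (measurable_const.indicator
      (measurableSet_le (by fun_prop) measurable_const)).aestronglyMeasurable
  · refine Filter.Eventually.of_forall fun t => Filter.Eventually.of_forall fun x => ?_
    by_cases h : |inner ℝ x θ| ≤ t <;> simp [indicator, h]
  · have : volume K ≠ ⊤ := hK.volume_ne_top_of_subset subset_rfl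
    exact (integrableOn_const this)
  · have : ∀ᵐ x ∂(volume.restrict K), ¬ |inner ℝ x θ| = t :=
      ae_restrict_of_ae (by
        rw [ae_iff]; simpa using volume_abs_inner_eq hθ t)
    filter_upwards [this] with x hx
    rcases lt_or_gt_of_ne hx with h | h
    · refine (continuousAt_const (y := (1 : ℝ))).congr ?_
      filter_upwards [lt_mem_nhds h] with u hu
      simp [indicator, hu.le]
    · refine (continuousAt_const (y := (0 : ℝ))).congr ?_
      filter_upwards [gt_mem_nhds h] with u hu
      simp [indicator, not_le.2 hu]

theorem exists_abs_inner_le (hK : IsSymmUnitBody K) (θ : EuclideanSpace ℝ (Fin n)) :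
    ∃ R, 0 < R ∧ ∀ x ∈ K, |inner ℝ x θ| ≤ R := by
  obtain ⟨C, hC⟩ := hK.isCompact.exists_bound_of_continuousOn
    (f := fun x => (inner ℝ x θ : ℝ)) (by fun_prop)
  exact ⟨max C 1, by positivity, fun x hx => (hC x hx).trans (le_max_left _ _)⟩

theorem slab_eq_one_of_forall (hK : IsSymmUnitBody K) (h : ∀ x ∈ K, |inner ℝ x θ| ≤ t) :
    volume.real (slab K θ t) = 1 := by
  have : slab K θ t = K := by
    ext x; exact ⟨fun h => h.1, fun hx => ⟨hx, h x hx⟩⟩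
  simp [this, Measure.real, hK.volume_eq]

theorem volume_slab_eq_iff (hK : IsSymmUnitBody K) (hδ1 : δ < 1) :
    volume {x ∈ K | |inner ℝ x θ| ≤ t} = ENNReal.ofReal (1 - δ) ↔
      volume.real (slab K θ t) = 1 - δ := by
  change volume (slab K θ t) = _ ↔ _
  have hf : volume (slab K θ t) ≠ ⊤ := hK.volume_ne_top_of_subset fun x hx => hx.1
  rw [Measure.real, ← ENNReal.toReal_eq_toReal_iff' hf ENNReal.ofReal_ne_top,
    ENNReal.toReal_ofReal (by linarith)]

theorem slabHalfWidth_mem (hK : IsSymmUnitBody K) (hθ : θ ≠ 0) (hδ : 0 < δ) (hδ1 : δ < 1) :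
    IsGreatest {t : ℝ | 0 < t ∧ volume.real (slab K θ t) = 1 - δ} (slabHalfWidth K δ θ) := by
  -- Allowing t = 0 makes the set closed and adds nothing, since the slab of half-width 0 is null
  -- and 1 - δ > 0.
  have e : {t : ℝ | 0 < t ∧ volume {x ∈ K | |inner ℝ x θ| ≤ t} = ENNReal.ofReal (1 - δ)} =
      {t : ℝ | 0 ≤ t ∧ volume.real (slab K θ t) = 1 - δ} := by
    ext t
    simp only [mem_ofPred_eq, hK.volume_slab_eq_iff hδ1]
    refine ⟨fun h => ⟨h.1.le, h.2⟩, fun h => ⟨lt_of_le_of_ne h.1 ?_, h.2⟩⟩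
    rintro rfl
    have := h.2
    rw [slab_zero hθ] at this
    linarith
  have e' : {t : ℝ | 0 < t ∧ volume.real (slab K θ t) = 1 - δ} =
      {t : ℝ | 0 ≤ t ∧ volume.real (slab K θ t) = 1 - δ} := by
    rw [← e]; ext t; simp only [mem_ofPred_eq, hK.volume_slab_eq_iff hδ1]
  obtain ⟨R, hR0, hR⟩ := hK.exists_abs_inner_le θ
  have bdd : BddAbove {t : ℝ | 0 ≤ t ∧ volume.real (slab K θ t) = 1 - δ} := by
    refine ⟨R, fun t ht => ?_⟩
    by_contra! h
    have := hK.slab_mono (θ := θ) h.le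
    rw [hK.slab_eq_one_of_forall hR, ht.2] at this
    linarith
  have ne : {t : ℝ | 0 ≤ t ∧ volume.real (slab K θ t) = 1 - δ}.Nonempty := by
    obtain ⟨t, ht, ht'⟩ := intermediate_value_Icc hR0.le (hK.continuous_slab hθ).continuousOn
      (show 1 - δ ∈ Icc _ _ by
        rw [slab_zero hθ, hK.slab_eq_one_of_forall hR]
        exact ⟨by linarith, by linarith⟩)
    exact ⟨t, ht.1, ht'⟩
  have closed : IsClosed {t : ℝ | 0 ≤ t ∧ volume.real (slab K θ t) = 1 - δ} :=
    (isClosed_le continuous_const continuous_id).inter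
      (isClosed_eq (hK.continuous_slab hθ) continuous_const)
  rw [slabHalfWidth, e, e']
  exact ⟨closed.csSup_mem ne bdd, fun t ht => le_csSup bdd ht⟩

theorem slabHalfWidth_pos (hK : IsSymmUnitBody K) (hθ : θ ≠ 0) (hδ : 0 < δ) (hδ1 : δ < 1) :
    0 < slabHalfWidth K δ θ := (hK.slabHalfWidth_mem hθ hδ hδ1).1.1

theorem volume_slab_slabHalfWidth (hK : IsSymmUnitBody K) (hθ : θ ≠ 0) (hδ : 0 < δ)
    (hδ1 : δ < 1) : volume.real (slab K θ (slabHalfWidth K δ θ)) = 1 - δ :=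
  (hK.slabHalfWidth_mem hθ hδ hδ1).1.2

theorem volume_slabCompl_slabHalfWidth (hK : IsSymmUnitBody K) (hθ : θ ≠ 0) (hδ : 0 < δ)
    (hδ1 : δ < 1) : volume.real (slabCompl K θ (slabHalfWidth K δ θ)) = δ := by
  have h1 := hK.volume_slab_slabHalfWidth hθ hδ hδ1
  have h2 := hK.slab_add_slabCompl (θ := θ) (t := slabHalfWidth K δ θ)
  linarith

theorem le_slabHalfWidth (hK : IsSymmUnitBody K) (hθ : θ ≠ 0) (hδ : 0 < δ) (hδ1 : δ < 1)
    (h : volume.real (slab K θ s) ≤ 1 - δ) : s ≤ slabHalfWidth K δ θ := by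
  by_contra! hlt
  have h1 := hK.volume_slab_slabHalfWidth hθ hδ hδ1
  have h2 := hK.slab_mono (θ := θ) hlt.le
  exact absurd ((hK.slabHalfWidth_mem hθ hδ hδ1).2
    ⟨(hK.slabHalfWidth_pos hθ hδ hδ1).trans hlt, by linarith⟩) (not_le.2 hlt)

theorem slabHalfWidth_le (hK : IsSymmUnitBody K) (hθ : θ ≠ 0) (hδ : 0 < δ) (hδ1 : δ < 1)
    (h : 1 - δ < volume.real (slab K θ s)) : slabHalfWidth K δ θ ≤ s := by
  by_contra! hlt
  have h1 := hK.volume_slab_slabHalfWidth hθ hδ hδ1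
  have h2 := hK.slab_mono (θ := θ) hlt.le
  linarith

theorem volume_neg_preimage (S : Set (EuclideanSpace ℝ (Fin n))) :
    volume.real {x | -x ∈ S} = volume.real S := by
  change (volume (-S)).toReal = _
  rw [Measure.measure_neg]
  rfl

theorem volume_slabCompl_eq (hK : IsSymmUnitBody K) (ht : 0 ≤ t) :
    volume.real (slabCompl K θ t) = 2 * volume.real (cap K θ t) := by
  have e : slabCompl K θ t = cap K θ t ∪ {x | -x ∈ cap K θ t} := by
    ext x
    constructor
    · rintro ⟨hx, h⟩
      rcases lt_abs.1 h with h | h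
      · exact Or.inl ⟨hx, h⟩
      · exact Or.inr ⟨hK.neg_mem x hx, by rwa [inner_neg_left]⟩
    · rintro (⟨hx, h⟩ | ⟨hx, h⟩)
      · exact ⟨hx, lt_abs.2 (Or.inl h)⟩
      · exact ⟨by simpa using hK.neg_mem _ hx, lt_abs.2 (Or.inr (by rwa [inner_neg_left] at h))⟩
  have sub2 : {x | -x ∈ cap K θ t} ⊆ K := fun x hx => by simpa using hK.neg_mem _ hx.1
  rw [e, measureReal_union _ (show MeasurableSet {x | -x ∈ cap K θ t} from
      measurable_neg hK.measurableSet_cap)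
    (hK.volume_ne_top_of_subset fun x hx => hx.1) (hK.volume_ne_top_of_subset sub2),
    volume_neg_preimage]
  · ring
  · rw [Set.disjoint_left]
    rintro x ⟨_, h1⟩ ⟨_, h2⟩
    rw [inner_neg_left] at h2
    linarith

theorem volume_slabCompl_zero (hK : IsSymmUnitBody K) (hθ : θ ≠ 0) :
    volume.real (slabCompl K θ 0) = 1 := by
  have := hK.slab_add_slabCompl (θ := θ) (t := 0)
  rwa [slab_zero hθ, zero_add] at this

theorem nonempty (hK : IsSymmUnitBody K) : K.Nonempty :=
  nonempty_of_measure_ne_zero (μ := volume) (by simp [hK.volume_eq])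

theorem zero_mem (hK : IsSymmUnitBody K) : (0 : EuclideanSpace ℝ (Fin n)) ∈ K := by
  obtain ⟨x, hx⟩ := hK.nonempty
  have := hK.convex hx (hK.neg_mem x hx) (a := 1 / 2) (b := 1 / 2) (by norm_num) (by norm_num)
    (by norm_num)
  simpa using this

theorem smul_mem (hK : IsSymmUnitBody K) {x : EuclideanSpace ℝ (Fin n)} (hx : x ∈ K) {c : ℝ}
    (h0 : 0 ≤ c) (h1 : c ≤ 1) : c • x ∈ K := by
  have := hK.convex hx hK.zero_mem h0 (sub_nonneg.2 h1) (by ring)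
  simpa using this

/-- The set (1 - s)x + s · cap(0) lies in K beyond height (1 - s)⟨x, θ⟩ and has volume s^n / 2 = δ /
2. By symmetry at least δ of the volume lies outside the slab of that half-width. -/
theorem mul_abs_inner_le_slabHalfWidth (hK : IsSymmUnitBody K) (hθ : θ ≠ 0) (hδ : 0 < δ)
    (hδ1 : δ < 1) (hs : 0 ≤ s) (hs1 : s ≤ 1) (hsn : s ^ n = δ)
    {x : EuclideanSpace ℝ (Fin n)} (hx : x ∈ K) :
    (1 - s) * |inner ℝ x θ| ≤ slabHalfWidth K δ θ := by
  wlog h0 : 0 ≤ inner ℝ x θ generalizing x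
  · have := this (hK.neg_mem x hx) (by rw [inner_neg_left]; linarith)
    rwa [inner_neg_left, abs_neg] at this
  rw [abs_of_nonneg h0]
  refine hK.le_slabHalfWidth hθ hδ hδ1 ?_
  have ht : 0 ≤ (1 - s) * inner ℝ x θ := mul_nonneg (by linarith) h0
  have h1 := hK.slab_add_slabCompl (θ := θ) (t := (1 - s) * inner ℝ x θ)
  have h2 := hK.volume_slabCompl_eq (θ := θ) ht
  have h3 := hK.volume_slabCompl_eq (θ := θ) le_rfl
  rw [hK.volume_slabCompl_zero hθ] at h3
  have h4 : s ^ n * volume.real (cap K θ 0) ≤ volume.real (cap K θ ((1 - s) * inner ℝ x θ)) := by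
    have e : s ^ n * volume.real (cap K θ 0) =
        volume.real (((1 - s) • x) +ᵥ (s • cap K θ 0)) := by
      rw [Measure.real, Measure.real, measure_vadd, Measure.addHaar_smul, ENNReal.toReal_mul]
      simp [abs_of_nonneg hs, ENNReal.toReal_ofReal (pow_nonneg hs n)]
    rw [e]
    refine hK.measureReal_mono ?_ fun x hx => hx.1
    rintro _ ⟨_, ⟨y, hy, rfl⟩, rfl⟩
    have s0 : 0 < s := lt_of_le_of_ne hs (by
      rintro rfl
      have : n ≠ 0 := by
        rintro rfl
        exact hθ (Subsingleton.elim _ _)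
      rw [zero_pow this] at hsn
      linarith)
    refine ⟨hK.convex hx hy.1 (by linarith) hs (by ring), ?_⟩
    simp only [vadd_eq_add, inner_add_left, inner_smul_left, conj_trivial]
    have := mul_pos s0 hy.2
    linarith
  rw [hsn] at h4
  have h5 : volume.real (cap K θ 0) = 1 / 2 := by linarith
  rw [h5] at h4
  linarith

theorem floatingBody_subset (hn : 1 ≤ n) : floatingBody K δ ⊆ K := by
  intro x hx
  have : Nonempty (Fin n) := ⟨⟨0, hn⟩⟩
  obtain ⟨θ, hθ⟩ := (NormedSpace.sphere_nonempty (E := EuclideanSpace ℝ (Fin n)) (x := 0)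
    (r := 1)).2 zero_le_one
  exact (mem_iInter₂.1 hx θ hθ).1

theorem smul_subset_floatingBody (hK : IsSymmUnitBody K) (hδ : 0 < δ) (hδ1 : δ < 1) (hs : 0 ≤ s)
    (hs1 : s ≤ 1) (hsn : s ^ n = δ) : (1 - s) • K ⊆ floatingBody K δ := by
  rintro _ ⟨x, hx, rfl⟩
  refine mem_iInter₂.2 fun θ hθ => ⟨hK.smul_mem hx (by linarith) (by linarith), ?_⟩
  have hθ0 : θ ≠ 0 := by rintro rfl; simp at hθ
  have := hK.mul_abs_inner_le_slabHalfWidth hθ0 hδ hδ1 hs hs1 hsn hx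
  rwa [inner_smul_left, conj_trivial, abs_mul, abs_of_nonneg (by linarith : 0 ≤ 1 - s)]

end IsSymmUnitBody

/-! ### Tail decay, slab half-widths and second moments. -/

theorem sum_two_mul_add_one_mul_half_pow_le (N : ℕ) :
    ∑ k ∈ Finset.range N, (2 * (k : ℝ) + 1) * (1 / 2) ^ k ≤ 6 := by
  have : ∑ k ∈ Finset.range N, (2 * (k : ℝ) + 1) * (1 / 2) ^ k =
      6 - (4 * N + 6) * (1 / 2) ^ N := by
    induction N with
    | zero => simp
    | succ N ih =>
      rw [Finset.sum_range_succ, ih]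
      push_cast
      ring
  rw [this]
  have : 0 ≤ (4 * (N : ℝ) + 6) * (1 / 2) ^ N := by positivity
  linarith

/-- A discrete layer-cake formula: the first M odd numbers sum to M², and T times the number of
active terms is at least `y`. -/
theorem sq_le_sq_mul_sum_indicator {T y : ℝ} (hT : 0 < T) (hy : 0 ≤ y) {N : ℕ} (h : y ≤ N * T) :
    y ^ 2 ≤ T ^ 2 * ∑ k ∈ Finset.range N, (2 * (k : ℝ) + 1) * if k * T < y then 1 else 0 := by
  induction N with
  | zero =>
    have : y = 0 := le_antisymm (by simpa using h) hy
    simp [this]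
  | succ N ih =>
    rcases le_or_gt y (N * T) with h' | h'
    · refine (ih h').trans ?_
      refine mul_le_mul_of_nonneg_left ?_ (sq_nonneg T)
      rw [Finset.sum_range_succ]
      refine le_add_of_nonneg_right (mul_nonneg (by positivity) ?_)
      split_ifs <;> simp
    · have hs : ∀ M : ℕ, ∑ k ∈ Finset.range M, (2 * (k : ℝ) + 1) = M ^ 2 := by
        intro M
        induction M with
        | zero => simp
        | succ M ih => rw [Finset.sum_range_succ, ih]; push_cast; ring
      have e : ∑ k ∈ Finset.range (N + 1), (2 * (k : ℝ) + 1) * (if k * T < y then 1 else 0) =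
          ((N + 1 : ℕ) : ℝ) ^ 2 := by
        rw [← hs]
        refine Finset.sum_congr rfl fun k hk => ?_
        have : (k : ℝ) ≤ N := by exact_mod_cast Nat.lt_succ_iff.1 (Finset.mem_range.1 hk)
        rw [if_pos (lt_of_le_of_lt (mul_le_mul_of_nonneg_right this hT.le) h'), mul_one]
      rw [e, ← mul_pow, mul_comm T]
      exact pow_le_pow_left₀ hy h 2

theorem rpow_measureReal_mul_rpow_measureReal_le {a b : ℝ} (ha : 0 < a) (hb : 0 < b)
    (hab : a + b = 1) {n : ℕ} {A B C : Set (EuclideanSpace ℝ (Fin n))} (hA : MeasurableSet A)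
    (hB : MeasurableSet B) (hC : MeasurableSet C) (hCt : volume C ≠ ⊤)
    (H : ∀ x ∈ A, ∀ y ∈ B, a • x + b • y ∈ C) :
    volume.real A ^ a * volume.real B ^ b ≤ volume.real C := by
  have := ENNReal.toReal_mono hCt (rpow_volume_mul_rpow_volume_le ha hb hab hA hB hC H)
  rwa [ENNReal.toReal_mul, ← ENNReal.toReal_rpow, ← ENNReal.toReal_rpow] at this

namespace IsSymmUnitBody

variable {n : ℕ} {K : Set (EuclideanSpace ℝ (Fin n))} {θ : EuclideanSpace ℝ (Fin n)}
  {δ t s T w : ℝ}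

theorem volume_slabCompl_le_one (hK : IsSymmUnitBody K) :
    volume.real (slabCompl K θ t) ≤ 1 := by
  have := hK.slab_add_slabCompl (θ := θ) (t := t)
  have h : 0 ≤ volume.real (slab K θ t) := measureReal_nonneg
  linarith

/-- Log-concavity of the tails of the marginals of a symmetric convex body. -/
theorem rpow_volume_slabCompl_le (hK : IsSymmUnitBody K) (hθ : θ ≠ 0) (ht : 0 ≤ t)
    (hs : 0 < s) (hs1 : s ≤ 1) :
    volume.real (slabCompl K θ t) ^ s ≤ volume.real (slabCompl K θ (s * t)) := by
  rcases hs1.eq_or_lt with rfl | hs1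
  · simp
  have h0 := hK.volume_slabCompl_eq (θ := θ) le_rfl
  rw [hK.volume_slabCompl_zero hθ] at h0
  have h0 : volume.real (cap K θ 0) = 1 / 2 := by linarith
  -- The complement of a slab is not convex, so one passes to caps: s · cap(t) + (1 - s) · cap(0) ⊆
  -- cap(st). Since cap(0) has volume 1/2, the factors 2 cancel.
  have key := rpow_measureReal_mul_rpow_measureReal_le (A := cap K θ t) (B := cap K θ 0)
    (C := cap K θ (s * t)) hs (sub_pos.2 hs1) (by ring) hK.measurableSet_cap hK.measurableSet_cap
    hK.measurableSet_cap (hK.volume_ne_top_of_subset fun x hx => hx.1) (by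
      intro x hx y hy
      refine ⟨hK.convex hx.1 hy.1 hs.le (sub_pos.2 hs1).le (by ring), ?_⟩
      simp only [inner_add_left, inner_smul_left, conj_trivial]
      have h1 := mul_lt_mul_of_pos_left hx.2 hs
      have h2 := mul_pos (sub_pos.2 hs1) hy.2
      linarith)
  rw [hK.volume_slabCompl_eq ht, hK.volume_slabCompl_eq (mul_nonneg hs.le ht),
    Real.mul_rpow zero_le_two measureReal_nonneg]
  rw [h0, one_div, Real.inv_rpow zero_le_two, Real.rpow_sub zero_lt_two, Real.rpow_one,
    inv_div] at key
  linarith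

theorem measurableSet_strip (hK : IsSymmUnitBody K) (c : ℝ) :
    MeasurableSet {x ∈ K | |inner ℝ x θ - c| ≤ w} :=
  hK.measurableSet.inter (measurableSet_le
    (by fun_prop : Measurable fun x : EuclideanSpace ℝ (Fin n) => |(inner ℝ x θ : ℝ) - c|)
    measurable_const)

/-- Among the strips of given width and direction, the central one has the largest volume. -/
theorem volume_strip_le_volume_slab (hK : IsSymmUnitBody K) (c : ℝ) :
    volume.real {x ∈ K | |inner ℝ x θ - c| ≤ w} ≤ volume.real (slab K θ w) := by
  set A := {x ∈ K | |inner ℝ x θ - c| ≤ w} with hA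
  -- Midpoints of the strip about c and its reflection about -c fall in the central slab.
  have key := rpow_measureReal_mul_rpow_measureReal_le (A := A) (B := {x | -x ∈ A})
    (C := slab K θ w) (a := 1 / 2) (b := 1 / 2) (by norm_num) (by norm_num) (by norm_num)
    (hK.measurableSet_strip c)
    (show MeasurableSet {x | -x ∈ A} from measurable_neg (hK.measurableSet_strip c))
    hK.measurableSet_slab (hK.volume_ne_top_of_subset fun x hx => hx.1) (by
      rintro x ⟨hx, hx'⟩ y ⟨hy, hy'⟩
      refine ⟨hK.convex hx (by simpa using hK.neg_mem _ hy) (by norm_num) (by norm_num)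
        (by norm_num), ?_⟩
      simp only [inner_add_left, inner_smul_left, conj_trivial, inner_neg_left] at hx' hy' ⊢
      rw [abs_le] at hx' hy' ⊢
      constructor <;> linarith [hx'.1, hx'.2, hy'.1, hy'.2])
  rwa [volume_neg_preimage, ← Real.rpow_add_of_nonneg measureReal_nonneg (by norm_num) (by norm_num),
    add_halves, Real.rpow_one] at key

theorem volume_slab_mul_le (hK : IsSymmUnitBody K) (hw : 0 < w) (hwT : w ≤ T) :
    volume.real (slab K θ T) * w ≤ 2 * T * volume.real (slab K θ w) := by
  -- That many strips of half-width w, centred at -T + (2k + 1)w, cover [-T, T]; since w ≤ T, also m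
  -- w ≤ 2T.
  set m := ⌊T / w⌋₊ + 1 with hm
  have cover : slab K θ T ⊆ ⋃ k ∈ Finset.range m,
      {x ∈ K | |inner ℝ x θ - (-T + (2 * (k : ℝ) + 1) * w)| ≤ w} := by
    rintro x ⟨hx, hxT⟩
    rw [abs_le] at hxT
    set y := (inner ℝ x θ + T) / (2 * w) with hy
    have hy0 : 0 ≤ y := div_nonneg (by linarith) (by linarith)
    have hyT : y ≤ T / w := by
      rw [hy, div_le_div_iff₀ (by linarith) hw]
      nlinarith
    have h1 := Nat.floor_le hy0
    have h2 := Nat.lt_floor_add_one y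
    have hyw : y * (2 * w) = inner ℝ x θ + T := div_mul_cancel₀ _ (by positivity)
    refine mem_iUnion₂.2 ⟨⌊y⌋₊, Finset.mem_range.2 (Nat.lt_succ_of_le (Nat.floor_mono hyT)), hx, ?_⟩
    rw [abs_le]
    constructor <;> nlinarith
  have h1 : volume.real (slab K θ T) ≤ m * volume.real (slab K θ w) := by
    calc volume.real (slab K θ T) ≤ _ := hK.measureReal_mono cover
          (iUnion₂_subset fun k _ x hx => hx.1)
      _ ≤ ∑ k ∈ Finset.range m, _ := measureReal_biUnion_finset_le _ _
      _ ≤ ∑ k ∈ Finset.range m, volume.real (slab K θ w) :=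
          Finset.sum_le_sum fun k _ => hK.volume_strip_le_volume_slab _
      _ = _ := by simp
  have h2 : (m : ℝ) * w ≤ 2 * T := by
    have : (⌊T / w⌋₊ : ℝ) ≤ T / w := Nat.floor_le (div_nonneg (hw.le.trans hwT) hw.le)
    have h3 := mul_le_mul_of_nonneg_right this hw.le
    rw [div_mul_cancel₀ _ hw.ne'] at h3
    rw [hm]; push_cast; linarith
  have h0 : 0 ≤ volume.real (slab K θ w) := measureReal_nonneg
  calc _ ≤ m * volume.real (slab K θ w) * w := by gcongr
    _ = (m * w) * volume.real (slab K θ w) := by ring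
    _ ≤ _ := by gcongr

theorem slabHalfWidth_anti (hK : IsSymmUnitBody K) (hθ : θ ≠ 0) {δ' : ℝ} (hδ : 0 < δ)
    (h : δ ≤ δ') (hδ1 : δ' < 1) : slabHalfWidth K δ' θ ≤ slabHalfWidth K δ θ := by
  refine hK.le_slabHalfWidth hθ hδ (h.trans_lt hδ1) ?_
  rw [hK.volume_slab_slabHalfWidth hθ (hδ.trans_le h) hδ1]
  linarith

/-- Comparison of the slab half-widths at two levels, from log-concavity of the tails. -/
theorem slabHalfWidth_mul_log_le (hK : IsSymmUnitBody K) (hθ : θ ≠ 0) {δ' : ℝ} (hδ : 0 < δ)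
    (h : δ ≤ δ') (hδ1 : δ' < 1) :
    slabHalfWidth K δ θ * Real.log (1 / δ') ≤ slabHalfWidth K δ' θ * Real.log (1 / δ) := by
  have hδ' := hδ.trans_le h
  have hδ1' := h.trans_lt hδ1
  have ht := hK.slabHalfWidth_pos hθ hδ hδ1'
  have ht' := hK.slabHalfWidth_pos hθ hδ' hδ1
  have hle := hK.slabHalfWidth_anti hθ hδ h hδ1
  have key := hK.rpow_volume_slabCompl_le (s := slabHalfWidth K δ' θ / slabHalfWidth K δ θ) hθ ht.le
    (div_pos ht' ht) ((div_le_one ht).2 hle)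
  rw [div_mul_cancel₀ _ ht.ne', hK.volume_slabCompl_slabHalfWidth hθ hδ hδ1',
    hK.volume_slabCompl_slabHalfWidth hθ hδ' hδ1] at key
  have := Real.log_le_log (Real.rpow_pos_of_pos hδ _) key
  rw [Real.log_rpow hδ, div_mul_eq_mul_div, div_le_iff₀ ht] at this
  simp only [one_div, Real.log_inv]
  linarith

theorem slabHalfWidth_le_of_half_le (hK : IsSymmUnitBody K) (hθ : θ ≠ 0) (h : 1 / 2 ≤ δ)
    (hδ1 : δ < 1) : slabHalfWidth K δ θ ≤ 4 * (1 - δ) * slabHalfWidth K (1 / 2) θ := by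
  have hδ : 0 < δ := by linarith
  have := hK.volume_slab_mul_le (θ := θ) (hK.slabHalfWidth_pos hθ hδ hδ1)
    (hK.slabHalfWidth_anti hθ (by norm_num) h hδ1)
  rw [hK.volume_slab_slabHalfWidth hθ hδ hδ1,
    hK.volume_slab_slabHalfWidth hθ (by norm_num) (by norm_num)] at this
  linarith

theorem le_slabHalfWidth_of_half_le (hK : IsSymmUnitBody K) (hθ : θ ≠ 0) (h : 1 / 2 ≤ δ)
    (hδ1 : δ < 1) : (1 - δ) * slabHalfWidth K (1 / 2) θ ≤ slabHalfWidth K δ θ := by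
  have hδ : 0 < δ := by linarith
  have h1 := hK.slabHalfWidth_mul_log_le hθ (by norm_num) h hδ1
  have ht := hK.slabHalfWidth_pos hθ hδ hδ1
  have ht' := hK.slabHalfWidth_pos (δ := 1 / 2) hθ (by norm_num) (by norm_num)
  have h2 : 1 - δ ≤ Real.log (1 / δ) := by
    rw [one_div, Real.log_inv]
    linarith [Real.log_le_sub_one_of_pos hδ]
  have h3 : Real.log (1 / (1 / 2)) ≤ 1 := by
    rw [one_div_one_div]; linarith [Real.log_two_lt_d9]
  calc _ ≤ Real.log (1 / δ) * slabHalfWidth K (1 / 2) θ := by gcongr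
    _ ≤ slabHalfWidth K δ θ * Real.log (1 / (1 / 2)) := by linarith
    _ ≤ slabHalfWidth K δ θ * 1 := by gcongr
    _ = _ := mul_one _

theorem slabHalfWidth_le_of_le_half (hK : IsSymmUnitBody K) (hθ : θ ≠ 0) (hδ : 0 < δ)
    (h : δ ≤ 1 / 2) :
    slabHalfWidth K δ θ ≤ 2 * Real.log (1 / δ) * slabHalfWidth K (1 / 2) θ := by
  have h1 := hK.slabHalfWidth_mul_log_le hθ hδ h (by norm_num)
  have ht := hK.slabHalfWidth_pos hθ hδ (by linarith)
  have h3 : 1 / 2 ≤ Real.log (1 / (1 / 2)) := by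
    rw [one_div_one_div]; linarith [Real.log_two_gt_d9]
  have := mul_le_mul_of_nonneg_left h3 ht.le
  linarith

theorem integrableOn_of_continuous (hK : IsSymmUnitBody K) {f : EuclideanSpace ℝ (Fin n) → ℝ}
    (hf : Continuous f) : IntegrableOn f K :=
  hf.continuousOn.integrableOn_compact hK.isCompact

/-- Markov's inequality at the median. -/
theorem sq_slabHalfWidth_half_le (hK : IsSymmUnitBody K) (hθ : θ ≠ 0) :
    slabHalfWidth K (1 / 2) θ ^ 2 ≤ 2 * ∫ x in K, (inner ℝ x θ : ℝ) ^ 2 := by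
  set T := slabHalfWidth K (1 / 2) θ with hT
  have hT0 : 0 < T := hK.slabHalfWidth_pos hθ (by norm_num) (by norm_num)
  have h1 := mul_meas_ge_le_integral_of_nonneg (μ := volume.restrict K)
    (f := fun x => (inner ℝ x θ : ℝ) ^ 2) (Filter.Eventually.of_forall fun x => sq_nonneg _)
    (hK.integrableOn_of_continuous (by fun_prop)) (T ^ 2)
  have h2 : 1 / 2 ≤ (volume.restrict K).real {x | T ^ 2 ≤ (inner ℝ x θ : ℝ) ^ 2} := by
    have hv := hK.volume_slabCompl_slabHalfWidth (δ := 1 / 2) hθ (by norm_num) (by norm_num)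
    rw [← hv, measureReal_restrict_apply (measurableSet_le measurable_const (by fun_prop))]
    refine hK.measureReal_mono ?_ inter_subset_right
    rintro x ⟨hx, hx'⟩
    exact ⟨sq_le_sq' (by linarith [abs_nonneg (inner ℝ x θ : ℝ)]) hx'.le |>.trans (sq_abs _).le, hx⟩
  nlinarith [mul_le_mul_of_nonneg_left h2 (sq_nonneg T)]

theorem volume_slabCompl_natCast_mul_le (hK : IsSymmUnitBody K) (hθ : θ ≠ 0) (k : ℕ) :
    volume.real (slabCompl K θ (k * slabHalfWidth K (1 / 2) θ)) ≤ (1 / 2) ^ k := by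
  rcases Nat.eq_zero_or_pos k with rfl | hk
  · simpa using hK.volume_slabCompl_le_one
  have hk' : (1 : ℝ) ≤ k := by exact_mod_cast hk
  have hT0 : 0 < slabHalfWidth K (1 / 2) θ := hK.slabHalfWidth_pos hθ (by norm_num) (by norm_num)
  have h := hK.rpow_volume_slabCompl_le (s := (k : ℝ)⁻¹)
    (t := k * slabHalfWidth K (1 / 2) θ) hθ (by positivity) (by positivity) (inv_le_one_of_one_le₀ hk')
  rw [inv_mul_cancel_left₀ (by positivity),
    hK.volume_slabCompl_slabHalfWidth hθ (by norm_num) (by norm_num)] at h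
  have := pow_le_pow_left₀ (by positivity) h k
  rwa [← Real.rpow_natCast, Real.rpow_inv_rpow measureReal_nonneg (by positivity)] at this

theorem integral_sq_inner_le (hK : IsSymmUnitBody K) (hθ : θ ≠ 0) :
    ∫ x in K, (inner ℝ x θ : ℝ) ^ 2 ≤ 6 * slabHalfWidth K (1 / 2) θ ^ 2 := by
  set T := slabHalfWidth K (1 / 2) θ with hT
  have hT0 : 0 < T := hK.slabHalfWidth_pos hθ (by norm_num) (by norm_num)
  obtain ⟨R, hR0, hR⟩ := hK.exists_abs_inner_le θ
  set N := ⌈R / T⌉₊ with hN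
  have hRN : R ≤ N * T := (div_le_iff₀ hT0).1 (Nat.le_ceil _)
  have hm : ∀ k : ℕ, MeasurableSet {x : EuclideanSpace ℝ (Fin n) | k * T < |inner ℝ x θ|} :=
    fun k => measurableSet_lt measurable_const measurable_abs_inner
  have hKt : volume K ≠ ⊤ := hK.volume_ne_top_of_subset subset_rfl
  have hi : ∀ k : ℕ, Integrable ({x : EuclideanSpace ℝ (Fin n) | k * T < |inner ℝ x θ|}.indicator
      (fun _ => (1 : ℝ))) (volume.restrict K) :=
    fun k => (integrableOn_const (C := (1 : ℝ)) hKt).indicator (hm k)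
  calc ∫ x in K, (inner ℝ x θ : ℝ) ^ 2
      ≤ ∫ x in K, T ^ 2 * ∑ k ∈ Finset.range N, (2 * (k : ℝ) + 1) *
          {x : EuclideanSpace ℝ (Fin n) | k * T < |inner ℝ x θ|}.indicator (fun _ => (1 : ℝ)) x := by
        refine setIntegral_mono_on (hK.integrableOn_of_continuous (by fun_prop)) ?_
          hK.measurableSet fun x hx => ?_
        · exact (integrable_finsetSum _ fun k _ => (hi k).const_mul _).const_mul _
        · have := sq_le_sq_mul_sum_indicator hT0 (abs_nonneg (inner ℝ x θ : ℝ))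
            ((hR x hx).trans hRN)
          rw [sq_abs] at this
          simpa [indicator] using this
    _ = T ^ 2 * ∑ k ∈ Finset.range N, (2 * (k : ℝ) + 1) *
          volume.real (slabCompl K θ (k * T)) := by
        rw [integral_const_mul, integral_finsetSum _ fun k _ => (hi k).const_mul _]
        congr 1
        refine Finset.sum_congr rfl fun k _ => ?_
        rw [integral_const_mul, integral_indicator (hm k)]
        simp only [integral_const, smul_eq_mul, mul_one]
        rw [measureReal_restrict_apply_univ, measureReal_restrict_apply (hm k), inter_comm]
        rfl
    _ ≤ T ^ 2 * ∑ k ∈ Finset.range N, (2 * (k : ℝ) + 1) * (1 / 2) ^ k := by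
        gcongr with k _
        exact hK.volume_slabCompl_natCast_mul_le hθ k
    _ ≤ T ^ 2 * 6 := by gcongr; exact sum_two_mul_add_one_mul_half_pow_le N
    _ = _ := mul_comm _ _

end IsSymmUnitBody

/-! ### The ellipsoid of second moments and the Banach–Mazur bound. -/

theorem Matrix.PosSemidef.exists_eq_conjTranspose_mul_self {n : ℕ} {M : Matrix (Fin n) (Fin n) ℝ}
    (hM : M.PosSemidef) : ∃ X : Matrix (Fin n) (Fin n) ℝ, M = X.conjTranspose * X := by
  open scoped MatrixOrder in
  obtain ⟨X, hX, -, rfl⟩ := CFC.exists_sqrt_of_isSelfAdjoint_of_quasispectrumRestricts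
    hM.isHermitian (QuasispectrumRestricts.nnreal_of_nonneg hM.nonneg)
  exact ⟨X, by rw [← Matrix.star_eq_conjTranspose, hX.star_eq]⟩

/-- The image of the unit ball under the adjoint of `L` is the ellipsoid with support
function `‖L θ‖`. -/
theorem mem_adjoint_image_closedBall_iff {n : ℕ}
    {L : EuclideanSpace ℝ (Fin n) →ₗ[ℝ] EuclideanSpace ℝ (Fin n)} (hL : Function.Injective L)
    {x : EuclideanSpace ℝ (Fin n)} :
    x ∈ LinearMap.adjoint L '' Metric.closedBall 0 1 ↔
      ∀ θ ∈ Metric.sphere (0 : EuclideanSpace ℝ (Fin n)) 1, |inner ℝ x θ| ≤ ‖L θ‖ := by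
  constructor
  · rintro ⟨y, hy, rfl⟩ θ _
    rw [LinearMap.adjoint_inner_left]
    refine (abs_real_inner_le_norm _ _).trans ?_
    rw [mem_closedBall_zero_iff] at hy
    exact mul_le_of_le_one_left (norm_nonneg _) hy
  · intro h
    have h' : ∀ θ, |inner ℝ x θ| ≤ ‖L θ‖ := by
      intro θ
      rcases eq_or_ne θ 0 with rfl | hθ
      · simp
      have hn : 0 < ‖θ‖ := norm_pos_iff.2 hθ
      have := h (‖θ‖⁻¹ • θ) (by simp [norm_smul, hn.ne'])
      rw [inner_smul_right, map_smul, norm_smul, abs_mul, Real.norm_eq_abs] at this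
      exact le_of_mul_le_mul_left this (by positivity)
    have surj : Function.Surjective L := LinearMap.injective_iff_surjective.1 hL
    have hadj : Function.Injective (LinearMap.adjoint L) := by
      rw [← LinearMap.ker_eq_bot, LinearMap.ker_eq_bot']
      intro y hy
      obtain ⟨θ, rfl⟩ := surj y
      rw [← inner_self_eq_zero (𝕜 := ℝ), ← LinearMap.adjoint_inner_left, hy, inner_zero_left]
    obtain ⟨y, rfl⟩ := LinearMap.injective_iff_surjective.1 hadj x
    refine ⟨y, ?_, rfl⟩
    -- Testing x = L*y against θ with Lθ = y gives ‖y‖² ≤ ‖y‖.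
    obtain ⟨θ, rfl⟩ := surj y
    have := h' θ
    rw [LinearMap.adjoint_inner_left, real_inner_self_eq_norm_sq, abs_of_nonneg (sq_nonneg _)] at this
    rw [mem_closedBall_zero_iff]
    by_contra! h1
    nlinarith

theorem geometricDist_le {n : ℕ} {K L : Set (EuclideanSpace ℝ (Fin n))} {a b : ℝ} (ha : 0 < a)
    (hb : 0 < b) (h1 : (1 / a) • K ⊆ L) (h2 : L ⊆ b • K) :
    geometricDist K L ≤ ENNReal.ofReal (a * b) :=
  sInf_le ⟨a, b, ha, hb, h1, h2, rfl⟩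

theorem geometricDist_le_mul {n : ℕ} {A K L : Set (EuclideanSpace ℝ (Fin n))} {p q : ℝ}
    (hp : 0 < p) (hq : 0 < q) (h1 : K ⊆ p • L) (h2 : L ⊆ q • K) :
    geometricDist A L ≤ ENNReal.ofReal (p * q) * geometricDist A K := by
  have hpq : 0 < p * q := mul_pos hp hq
  rw [mul_comm (ENNReal.ofReal _), ← ENNReal.div_le_iff_le_mul (Or.inl (by simpa using hpq)) (Or.inl ENNReal.ofReal_ne_top)]
  refine le_sInf ?_
  rintro r ⟨a, b, ha, hb, h3, h4, rfl⟩
  rw [ENNReal.div_le_iff_le_mul (Or.inl (by simpa using hpq)) (Or.inl ENNReal.ofReal_ne_top),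
    ← ENNReal.ofReal_mul (mul_nonneg ha.le hb.le)]
  have h5 : (1 / (p * a)) • A ⊆ L := by
    have : (1 / (p * a)) • A = p⁻¹ • ((1 / a) • A) := by
      rw [smul_smul]; congr 1; field_simp
    rw [this, ← Set.subset_smul_set_iff₀ hp.ne']
    exact h3.trans h1
  have h6 : L ⊆ (q * b) • A := by
    rw [← smul_smul]
    exact h2.trans (smul_set_mono h4)
  convert geometricDist_le (mul_pos hp ha) (mul_pos hq hb) h5 h6 using 2
  ring

namespace IsSymmUnitBody

variable {n : ℕ} {K : Set (EuclideanSpace ℝ (Fin n))} {θ : EuclideanSpace ℝ (Fin n)}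
  {δ t s T w : ℝ}

/-- A linear map whose adjoint maps the unit ball to the ellipsoid of second moments of `K`. -/
theorem exists_linearMap_norm_sq_eq (hK : IsSymmUnitBody K) :
    ∃ L : EuclideanSpace ℝ (Fin n) →ₗ[ℝ] EuclideanSpace ℝ (Fin n),
      ∀ θ, ‖L θ‖ ^ 2 = ∫ x in K, (inner ℝ x θ : ℝ) ^ 2 := by
  let M : Matrix (Fin n) (Fin n) ℝ := fun i j => ∫ x in K, x i * x j
  have hq : ∀ θ : Fin n → ℝ, θ ⬝ᵥ (M.mulVec θ) =
      ∫ x in K, (inner ℝ x (WithLp.toLp 2 θ) : ℝ) ^ 2 := by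
    intro θ
    have e : ∀ x : EuclideanSpace ℝ (Fin n), (inner ℝ x (WithLp.toLp 2 θ) : ℝ) ^ 2 =
        ∑ i, ∑ j, θ i * (x i * x j * θ j) := by
      intro x
      rw [PiLp.inner_apply, sq, Finset.sum_mul_sum]
      refine Finset.sum_congr rfl fun i _ => Finset.sum_congr rfl fun j _ => ?_
      simp only [RCLike.inner_apply, conj_trivial]
      ring
    simp_rw [e]
    rw [integral_finsetSum _ fun i _ => hK.integrableOn_of_continuous (by fun_prop)]
    simp only [dotProduct, Matrix.mulVec, Finset.mul_sum]
    refine Finset.sum_congr rfl fun i _ => ?_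
    rw [integral_finsetSum _ fun j _ => hK.integrableOn_of_continuous (by fun_prop)]
    refine Finset.sum_congr rfl fun j _ => ?_
    rw [integral_const_mul, integral_mul_const]
  have hM : M.PosSemidef := by
    refine .of_dotProduct_mulVec_nonneg ?_ fun θ => ?_
    · ext i j
      rw [Matrix.conjTranspose_apply, star_trivial]
      simp only [M, mul_comm]
    · rw [star_trivial, hq]
      exact integral_nonneg fun x => sq_nonneg _
  obtain ⟨X, hX⟩ := hM.exists_eq_conjTranspose_mul_self
  refine ⟨Matrix.toEuclideanLin X, fun θ => ?_⟩
  have := hq θ.ofLp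
  rw [hX, ← Matrix.mulVec_mulVec, Matrix.dotProduct_mulVec, Matrix.conjTranspose_eq_transpose_of_trivial,
    Matrix.vecMul_transpose] at this
  rw [← this, EuclideanSpace.real_norm_sq_eq]
  simp [dotProduct, Matrix.toLpLin_apply, sq]

/-- The floating body is cut out by its slabs alone. -/
theorem mem_floatingBody_of_forall (hK : IsSymmUnitBody K) (hδ : 0 < δ) (hδ1 : δ < 1)
    {x : EuclideanSpace ℝ (Fin n)}
    (h : ∀ θ ∈ Metric.sphere (0 : EuclideanSpace ℝ (Fin n)) 1,
      |inner ℝ x θ| ≤ slabHalfWidth K δ θ) : x ∈ floatingBody K δ := by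
  suffices hx : x ∈ K from mem_iInter₂.2 fun θ hθ => ⟨hx, h θ hθ⟩
  by_contra hx
  -- By symmetry, a hyperplane separating x from K yields a slab containing K but not x. Its
  -- half-width bounds `slabHalfWidth` in that direction, contradicting `h`.
  obtain ⟨f, u, hu, hux⟩ := geometric_hahn_banach_closed_point hK.convex hK.isCompact.isClosed hx
  set v := (InnerProductSpace.toDual ℝ (EuclideanSpace ℝ (Fin n))).symm f with hv
  have hf : ∀ y, f y = inner ℝ y v := fun y => by
    rw [real_inner_comm, hv, InnerProductSpace.toDual_symm_apply]
  have hu0 : 0 < u := by simpa using hu 0 hK.zero_mem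
  have hv0 : v ≠ 0 := by
    intro hv0
    have := hf x
    rw [hv0, inner_zero_right] at this
    linarith
  have hn : 0 < ‖v‖ := norm_pos_iff.2 hv0
  have hθ : ‖v‖⁻¹ • v ∈ Metric.sphere (0 : EuclideanSpace ℝ (Fin n)) 1 := by
    simp [norm_smul, hn.ne']
  have h1 := h _ hθ
  have hθ0 : ‖v‖⁻¹ • v ≠ 0 := smul_ne_zero (by positivity) hv0
  have h2 : slabHalfWidth K δ (‖v‖⁻¹ • v) ≤ ‖v‖⁻¹ * u := by
    refine hK.slabHalfWidth_le hθ0 hδ hδ1 ?_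
    rw [hK.slab_eq_one_of_forall fun y hy => ?_]
    · linarith
    · rw [inner_smul_right, abs_mul, abs_of_pos (inv_pos.2 hn)]
      refine mul_le_mul_of_nonneg_left (abs_le.2 ⟨?_, ?_⟩) (by positivity)
      · have := hu _ (hK.neg_mem y hy)
        rw [hf, inner_neg_left] at this
        linarith
      · have := hu _ hy
        rw [hf] at this
        exact this.le
  have h3 := h1.trans h2
  rw [inner_smul_right, abs_mul, abs_of_pos (inv_pos.2 hn)] at h3
  have h4 := le_of_mul_le_mul_left h3 (inv_pos.2 hn)
  rw [hf] at hux
  linarith [le_abs_self (inner ℝ x v : ℝ)]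

/-- If all slab half-widths at level `δ` are comparable to those at level `1 / 2`, the floating
body is close to the ellipsoid of second moments. -/
theorem banachMazurDist_floatingBody_le (hK : IsSymmUnitBody K) (hδ : 0 < δ)
    (hδ1 : δ < 1) {l u : ℝ} (hl : 0 < l) (hu : 0 < u)
    (hlo : ∀ θ : EuclideanSpace ℝ (Fin n), θ ≠ 0 →
      l * slabHalfWidth K (1 / 2) θ ≤ slabHalfWidth K δ θ)
    (hup : ∀ θ : EuclideanSpace ℝ (Fin n), θ ≠ 0 →
      slabHalfWidth K δ θ ≤ u * slabHalfWidth K (1 / 2) θ) :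
    banachMazurDist (floatingBody K δ) (Metric.closedBall 0 1) ≤
      ENNReal.ofReal (6 * (u / l)) := by
  obtain ⟨L, hL⟩ := hK.exists_linearMap_norm_sq_eq
  have hT : ∀ θ : EuclideanSpace ℝ (Fin n), θ ≠ 0 → 0 < slabHalfWidth K (1 / 2) θ :=
    fun θ hθ => hK.slabHalfWidth_pos hθ (by norm_num) (by norm_num)
  have h1 : ∀ θ, θ ≠ 0 → slabHalfWidth K (1 / 2) θ ≤ 2 * ‖L θ‖ := by
    intro θ hθ
    have := hK.sq_slabHalfWidth_half_le hθ
    rw [← hL] at this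
    exact abs_le_of_sq_le_sq' (by nlinarith [norm_nonneg (L θ)]) (by positivity) |>.2
  have h2 : ∀ θ, θ ≠ 0 → ‖L θ‖ ≤ 3 * slabHalfWidth K (1 / 2) θ := by
    intro θ hθ
    have := hK.integral_sq_inner_le hθ
    rw [← hL] at this
    exact abs_le_of_sq_le_sq' (by nlinarith [hT θ hθ]) (by linarith [hT θ hθ]) |>.2
  have inj : Function.Injective L := by
    rw [← LinearMap.ker_eq_bot, LinearMap.ker_eq_bot']
    intro θ hθ
    by_contra h
    have h3 := h1 θ h
    rw [hθ, norm_zero] at h3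
    linarith [hT θ h]
  have sphere_ne : ∀ θ ∈ Metric.sphere (0 : EuclideanSpace ℝ (Fin n)) 1, θ ≠ 0 := by
    rintro θ hθ rfl
    simp at hθ
  -- The factors 2 and 3 are convenient bounds for √2 and √6 in the comparison of the median with
  -- `‖L θ‖`.
  have e : 6 * (u / l) = (2 * u) * (3 / l) := by ring
  rw [e]
  refine (iInf_le _ (LinearMap.adjoint L)).trans
    (geometricDist_le (by positivity) (by positivity) ?_ ?_)
  · rintro _ ⟨x, hx, rfl⟩
    refine (mem_adjoint_image_closedBall_iff inj).2 fun θ hθ => ?_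
    have hθ0 := sphere_ne θ hθ
    have h3 := (mem_iInter₂.1 hx θ hθ).2
    have h4 := hup θ hθ0
    rw [inner_smul_left, conj_trivial, abs_mul, abs_of_pos (by positivity), one_div,
      inv_mul_le_iff₀ (by positivity)]
    calc _ ≤ u * slabHalfWidth K (1 / 2) θ := h3.trans h4
      _ ≤ u * (2 * ‖L θ‖) := by gcongr; exact h1 θ hθ0
      _ = _ := by ring
  · intro x hx
    rw [mem_smul_set_iff_inv_smul_mem₀ (by positivity)]
    refine hK.mem_floatingBody_of_forall hδ hδ1 fun θ hθ => ?_
    have hθ0 := sphere_ne θ hθ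
    have h3 := (mem_adjoint_image_closedBall_iff inj).1 hx θ hθ
    rw [inner_smul_left, conj_trivial, abs_mul, abs_of_pos (by positivity),
      inv_mul_le_iff₀ (by positivity), div_mul_eq_mul_div, le_div_iff₀ hl]
    calc |inner ℝ x θ| * l ≤ 3 * slabHalfWidth K (1 / 2) θ * l := by
          gcongr; exact h3.trans (h2 θ hθ0)
      _ = 3 * (l * slabHalfWidth K (1 / 2) θ) := by ring
      _ ≤ _ := by gcongr; exact hlo θ hθ0

theorem banachMazurDist_floatingBody_le_log (hK : IsSymmUnitBody K) (hδ : 0 < δ)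
    (hδ1 : δ < 1) :
    banachMazurDist (floatingBody K δ) (Metric.closedBall 0 1) ≤
      ENNReal.ofReal (24 * max (Real.log (1 / δ)) 1) := by
  rcases le_total (1 / 2) δ with h | h
  · have h1 : 0 < 1 - δ := by linarith
    refine (hK.banachMazurDist_floatingBody_le hδ hδ1 h1 (mul_pos four_pos h1)
      (fun θ hθ => hK.le_slabHalfWidth_of_half_le hθ h hδ1)
      (fun θ hθ => hK.slabHalfWidth_le_of_half_le hθ h hδ1)).trans (ENNReal.ofReal_le_ofReal ?_)
    rw [mul_div_cancel_right₀ _ h1.ne']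
    linarith [le_max_right (Real.log (1 / δ)) 1]
  · have h1 : 0 < Real.log (1 / δ) := Real.log_pos (by rw [lt_div_iff₀ hδ]; linarith)
    refine (hK.banachMazurDist_floatingBody_le hδ hδ1 one_pos (mul_pos two_pos h1)
      (fun θ hθ => by rw [one_mul]; exact hK.slabHalfWidth_anti hθ hδ h (by norm_num))
      (fun θ hθ => hK.slabHalfWidth_le_of_le_half hθ hδ h)).trans (ENNReal.ofReal_le_ofReal ?_)
    rw [div_one]
    linarith [le_max_left (Real.log (1 / δ)) 1]

/-! ### Geometric distances between K_δ, K and K_{e^(-n)}. -/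

theorem subset_smul_floatingBody (hK : IsSymmUnitBody K) (hδ : 0 < δ) (hδ1 : δ < 1) (hs : 0 ≤ s)
    (hs1 : s < 1) (hsn : s ^ n = δ) : K ⊆ (1 / (1 - s)) • floatingBody K δ := by
  have h : 0 < 1 - s := by linarith
  rw [Set.subset_smul_set_iff₀ (by positivity), one_div, inv_inv]
  exact hK.smul_subset_floatingBody hδ hδ1 hs hs1.le hsn

/-- At δ = e^(-n) the contraction ratio is s = 1/e, and 1 - 1/e ≥ 1/2. -/
theorem subset_two_smul_floatingBody_exp (hK : IsSymmUnitBody K) (hn : 1 ≤ n) :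
    K ⊆ (2 : ℝ) • floatingBody K (Real.exp (-(n : ℝ))) := by
  have h1 : Real.exp (-1) ≤ 1 / 2 := by linarith [Real.exp_neg_one_lt_d9]
  have hn' : (1 : ℝ) ≤ n := by exact_mod_cast hn
  have hd : Real.exp (-(n : ℝ)) < 1 := Real.exp_lt_one_iff.2 (by linarith)
  have h2 := hK.smul_subset_floatingBody (Real.exp_pos _) hd (Real.exp_pos _).le (by linarith)
    (show Real.exp (-1) ^ n = _ by rw [← Real.exp_nat_mul]; congr 1; ring)
  rw [Set.subset_smul_set_iff₀ two_ne_zero]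
  refine subset_trans ?_ h2
  rintro _ ⟨x, hx, rfl⟩
  have h3 : 0 < 1 - Real.exp (-1) := by linarith
  refine ⟨((1 - Real.exp (-1))⁻¹ * 2⁻¹) • x, hK.smul_mem hx (by positivity) ?_, ?_⟩
  · rw [inv_mul_le_iff₀ h3]; linarith
  · simp only [smul_smul]; rw [mul_inv_cancel_left₀ h3.ne']

theorem geometricDist_floatingBody_exp_le (hK : IsSymmUnitBody K) (hn : 1 ≤ n) (hδ : 0 < δ)
    (hδ1 : δ < 1) :
    geometricDist (floatingBody K δ) (floatingBody K (Real.exp (-(n : ℝ)))) ≤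
      ENNReal.ofReal (4 * max (n / Real.log (1 / δ)) 1) := by
  have hn' : (0 : ℝ) < n := by exact_mod_cast hn
  have hlog : 0 < Real.log (1 / δ) := Real.log_pos (by rw [lt_div_iff₀ hδ]; linarith)
  -- Chosen so that e^(-x) = δ^(1/n).
  set x := Real.log (1 / δ) / n with hx
  have hx0 : 0 < x := div_pos hlog hn'
  have hs1 : Real.exp (-x) < 1 := Real.exp_lt_one_iff.2 (by linarith)
  have hsn : Real.exp (-x) ^ n = δ := by
    rw [← Real.exp_nat_mul, hx, one_div, Real.log_inv]
    have : (n : ℝ) * -(-Real.log δ / n) = Real.log δ := by field_simp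
    rw [this, Real.exp_log hδ]
  have hpos : 0 < 1 - Real.exp (-x) := by linarith
  have h1 := hK.subset_smul_floatingBody hδ hδ1 (Real.exp_pos _).le hs1 hsn
  have h2 : (1 / (2 : ℝ)) • floatingBody K δ ⊆ floatingBody K (Real.exp (-(n : ℝ))) := by
    rw [one_div, ← Set.subset_smul_set_iff₀ two_ne_zero]
    exact (floatingBody_subset hn).trans (hK.subset_two_smul_floatingBody_exp hn)
  refine (geometricDist_le two_pos (by positivity) h2 ((floatingBody_subset hn).trans h1)).trans
    (ENNReal.ofReal_le_ofReal ?_)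
  -- This is 1/(1 - e^(-x)) ≤ 1 + 1/x, a form of 1 + x ≤ e^x.
  have h3 : 1 / (1 - Real.exp (-x)) ≤ n / Real.log (1 / δ) + 1 := by
    have e : n / Real.log (1 / δ) + 1 = (1 + x) / x := by
      rw [hx]; field_simp
    rw [e, div_le_div_iff₀ hpos hx0]
    have h4 := Real.add_one_le_exp x
    have h5 : Real.exp (-x) * (1 + x) ≤ 1 := by
      rw [Real.exp_neg, inv_mul_le_iff₀ (Real.exp_pos x)]; linarith
    linarith
  linarith [le_max_left ((n : ℝ) / Real.log (1 / δ)) 1, le_max_right ((n : ℝ) / Real.log (1 / δ)) 1]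

end IsSymmUnitBody

theorem mainTheorem10 :
    ∃ c₁ c₂ c₃ c₄ : ℝ, 0 < c₁ ∧ 0 < c₂ ∧ 0 < c₃ ∧ 0 < c₄ ∧
      ∀ (n : ℕ), 1 ≤ n →
      ∀ (K : Set (EuclideanSpace ℝ (Fin n))),
        Convex ℝ K → IsCompact K → (interior K).Nonempty → (∀ x ∈ K, -x ∈ K) → volume K = 1 →
      ∀ (δ : ℝ), 0 < δ → δ < 1 →
        banachMazurDist (floatingBody K δ) (Metric.closedBall 0 1)
            ≤ ENNReal.ofReal (c₁ * max (Real.log (1 / δ)) 1) ∧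
        (ENNReal.ofReal c₃ * geometricDist (floatingBody K δ) K
            ≤ geometricDist (floatingBody K δ) (floatingBody K (Real.exp (-(n : ℝ)))) ∧
          geometricDist (floatingBody K δ) (floatingBody K (Real.exp (-(n : ℝ))))
            ≤ ENNReal.ofReal c₄ * geometricDist (floatingBody K δ) K) ∧
        geometricDist (floatingBody K δ) (floatingBody K (Real.exp (-(n : ℝ))))
            ≤ ENNReal.ofReal (c₂ * max (n / Real.log (1 / δ)) 1) := by
  -- 24 = 6 · 4 comes from the range δ ≥ 1/2; 1/2 and 2 come from K_{e^(-n)} ⊆ K ⊆ 2 K_{e^(-n)}.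
  refine ⟨24, 4, 1 / 2, 2, by norm_num, by norm_num, by norm_num, by norm_num, ?_⟩
  intro n hn K hconv hcomp _ hsymm hvol δ hδ hδ1
  have hK : IsSymmUnitBody K := ⟨hconv, hcomp, hsymm, hvol⟩
  have h1 : floatingBody K (Real.exp (-(n : ℝ))) ⊆ (1 : ℝ) • K := by
    rw [one_smul]; exact IsSymmUnitBody.floatingBody_subset hn
  have h2 := hK.subset_two_smul_floatingBody_exp hn
  refine ⟨hK.banachMazurDist_floatingBody_le_log hδ hδ1, ⟨?_, ?_⟩,
    hK.geometricDist_floatingBody_exp_le hn hδ hδ1⟩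
  · have h3 := geometricDist_le_mul (A := floatingBody K δ) one_pos two_pos h1 h2
    calc _ ≤ ENNReal.ofReal (1 / 2) * (ENNReal.ofReal (1 * 2) *
          geometricDist (floatingBody K δ) (floatingBody K (Real.exp (-(n : ℝ))))) := by gcongr
      _ = _ := by
        rw [← mul_assoc, ← ENNReal.ofReal_mul (by norm_num)]
        norm_num
  · simpa using geometricDist_le_mul (A := floatingBody K δ) two_pos one_pos h2 h1
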